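/- Let $n\ge 1$, let $\mathcal H_1,\dots,\mathcal H_n$ be complex Hilbert spaces, let $T_i$ be an arbitrary bounded linear operator on $\mathcal H_i$, and let $\mathcal Q_i\subseteq\mathcal H_i$ be a closed subspace with $T_i^*\mathcal Q_i\subseteq\mathcal Q_i$, for $i=1,\dots,n$. Let $\tilde{\mathcal H}=\mathcal H_1\otimes\cdots\otimes\mathcal H_n$ be the Hilbert space tensor product and, for a bounded operator $A$ on $\mathcal H_i$, let $\tilde A=I_{\mathcal H_1}\otimes\cdots\otimes I_{\mathcal H_{i-1}}\otimes A\otimes I_{\mathcal H_{i+1}}\otimes\cdots\otimes I_{\mathcal H_n}$ on $\tilde{\mathcal H}$. Put $\tilde T=(\tilde T_1,\dots,\tilde T_n)$, let $P_i$ be the orthogonal projection of $\mathcal H_i$ onto $\mathcal Q_i^\perp$, let $Q_i=I_{\mathcal H_i}-P_i$, and set $$\mathcal S=(\mathcal Q_1\otimes\cdots\otimes\mathcal Q_n)^\perp\subseteq\tilde{\mathcal H},\qquad \mathcal M_i=\operatorname{ran}\Big(\tilde P_i\prod_{j\ne i}\tilde Q_j\Big),\qquad \mathcal F=\mathcal M_1\oplus\cdots\oplus\mathcal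 M_n ,$$ where $\mathcal Q_1\otimes\cdots\otimes\mathcal Q_n$ is the closed linear span of the tensors $q_1\otimes\cdots\otimes q_n$ with $q_i\in\mathcal Q_i$. For an $n$-tuple $A=(A_1,\dots,A_n)$ of commuting bounded operators on a Hilbert space $\mathcal K$, let $\operatorname{mult}_A(\mathcal K)$ be the least cardinality of a set $G\subseteq\mathcal K$ such that the closed linear span of $\{A_1^{k_1}\cdots A_n^{k_n}g : g\in G,\ k_1,\dots,k_n\ge 0\}$ is $\mathcal K$. Then the subspaces $\mathcal M_1,\dots,\mathcal M_n$ are pairwise orthogonal with closed sum $\mathcal F$; $\mathcal F\subseteq\mathcal S$; $\mathcal S$ is invariant under $\tilde T_1,\dots,\tilde T_n$; the compressions $P_{\mathcal F}\tilde T_1|_{\mathcal F},\dots,P_{\mathcal F}\tilde T_n|_{\mathcal F}$ commute; and $$\operatorname{mult}_{\tilde T|_{\mathcal S}}(\mathcal S)\ \ge\ \operatorname{mult}_{P_{\mathcal F}\tilde T|_{\mathcal F}}(\mathcal F).$$ -/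

import Mathlib

open scoped ComplexConjugate

noncomputable section

namespace HilbertTensor

section Algebraic

open scoped ComplexOrder

variable {ι : Type*} {H : ι → Type*}
  [∀ i, NormedAddCommGroup (H i)] [∀ i, InnerProductSpace ℂ (H i)]

/-- The algebraic tensor product `⨂ i, H i` over `ℂ`, as a type of its own, so that it can carry
the Hilbert space tensor norm below (and not the projective norm). -/
def Alg {ι : Type*} (H : ι → Type*)
    [∀ i, NormedAddCommGroup (H i)] [∀ i, InnerProductSpace ℂ (H i)] : Type _ :=
  PiTensorProduct ℂ H

instance : AddCommGroup (Alg H) := inferInstanceAs (AddCommGroup (PiTensorProduct ℂ H))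

instance : Module ℂ (Alg H) := inferInstanceAs (Module ℂ (PiTensorProduct ℂ H))

/-- The elementary tensor `x_1 ⊗ ⋯ ⊗ x_n` in the algebraic tensor product. -/
def algTmul : MultilinearMap ℂ H (Alg H) := PiTensorProduct.tprod ℂ

theorem alg_span_eq_top : Submodule.span ℂ (Set.range (algTmul (H := H))) = ⊤ :=
  PiTensorProduct.span_tprod_eq_top

theorem alg_exists_sum (t : Alg H) : ∃ (m : ℕ) (c : Fin m → ℂ) (x : Fin m → ∀ i, H i),
    t = ∑ k, c k • algTmul (x k) := by
  have ht : t ∈ Submodule.span ℂ (Set.range (algTmul (H := H))) := by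
    rw [alg_span_eq_top]; trivial
  obtain ⟨m, c, g, hg⟩ := Submodule.mem_span_set'.1 ht
  choose x hx using fun k => (g k).2
  exact ⟨m, c, x, by simp only [hx]; exact hg.symm⟩

variable [Fintype ι]

/-- The multilinear map `x ↦ ∏ i, ⟪y_i, x_i⟫`. -/
def innerMulti (y : ∀ i, H i) : MultilinearMap ℂ H ℂ :=
  (MultilinearMap.mkPiAlgebra ℂ ι ℂ).compLinearMap fun i => innerₛₗ ℂ (y i)

theorem innerMulti_apply (y x : ∀ i, H i) :
    innerMulti y x = ∏ i, inner ℂ (y i) (x i) := by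
  simp [innerMulti]

theorem conj_innerMulti (y x : ∀ i, H i) : conj (innerMulti y x) = innerMulti x y := by
  simp [innerMulti_apply, map_prod]

/-- The linear functional on the algebraic tensor product with
`x_1 ⊗ ⋯ ⊗ x_n ↦ ∏ i, ⟪y_i, x_i⟫`. -/
def innerElem (y : ∀ i, H i) : Alg H →ₗ[ℂ] ℂ := PiTensorProduct.lift (innerMulti y)

theorem innerElem_algTmul (y x : ∀ i, H i) : innerElem y (algTmul x) = innerMulti y x :=
  PiTensorProduct.lift.tprod x

/-- The conjugate linear functional `s ↦ conj (innerElem y s)`. -/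
def conjInnerElem (y : ∀ i, H i) : Alg H →ₗ⋆[ℂ] ℂ :=
  (starLinearEquiv ℂ (A := ℂ)).toLinearMap.comp (innerElem y)

theorem conjInnerElem_algTmul (y x : ∀ i, H i) :
    conjInnerElem y (algTmul x) = innerMulti x y := by
  rw [← conj_innerMulti, ← innerElem_algTmul]
  rfl

/-- The sesquilinear form on the algebraic tensor product with
`innerForm (y_1 ⊗ ⋯ ⊗ y_n) (x_1 ⊗ ⋯ ⊗ x_n) = ∏ i, ⟪x_i, y_i⟫`, linear in the first and conjugate
linear in the second argument. -/
def innerForm : Alg H →ₗ[ℂ] Alg H →ₗ⋆[ℂ] ℂ :=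
  PiTensorProduct.lift
    { toFun := conjInnerElem
      map_update_add' := by
        intro _ y i a b
        refine LinearMap.ext_on_range alg_span_eq_top fun x => ?_
        rw [LinearMap.add_apply]
        simp only [conjInnerElem_algTmul]
        exact (innerMulti x).map_update_add y i a b
      map_update_smul' := by
        intro _ y i r a
        refine LinearMap.ext_on_range alg_span_eq_top fun x => ?_
        rw [LinearMap.smul_apply]
        simp only [conjInnerElem_algTmul]
        exact (innerMulti x).map_update_smul y i r a }

theorem innerForm_algTmul (y x : ∀ i, H i) :
    innerForm (algTmul y) (algTmul x) = ∏ i, inner ℂ (x i) (y i) := by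
  have h : innerForm (algTmul y) = conjInnerElem y := PiTensorProduct.lift.tprod y
  rw [h, conjInnerElem_algTmul, innerMulti_apply]

theorem innerForm_sum {m : ℕ} (c d : Fin m → ℂ) (x y : Fin m → ∀ i, H i) :
    innerForm (∑ l, d l • algTmul (y l)) (∑ k, c k • algTmul (x k)) =
      ∑ k, ∑ l, conj (c k) * (∏ i, inner ℂ (x k i) (y l i)) * d l := by
  simp only [map_sum, map_smul, LinearMap.sum_apply, LinearMap.smul_apply, map_smulₛₗ,
    innerForm_algTmul, smul_eq_mul]
  simp only [Finset.mul_sum]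
  refine Finset.sum_congr rfl fun k _ => Finset.sum_congr rfl fun l _ => by ring

/-- An entrywise product of positive semidefinite matrices is positive semidefinite. -/
theorem posSemidef_prod {κ m : Type*} [Finite m] (s : Finset κ)
    (A : κ → Matrix m m ℂ)
    (hA : ∀ i ∈ s, (A i).PosSemidef) :
    (Matrix.of fun k l => ∏ i ∈ s, A i k l).PosSemidef := by
  classical
  induction s using Finset.induction_on with
  | empty =>
    have h : (Matrix.of fun k l => ∏ i ∈ (∅ : Finset κ), A i k l) =
        Matrix.gram ℂ (fun _ : m => (1 : ℂ)) := by
      ext k l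
      simp
    rw [h]
    exact Matrix.posSemidef_gram ℂ _
  | insert a s ha ih =>
    have h : (Matrix.of fun k l => ∏ i ∈ insert a s, A i k l) =
        (A a).hadamard (Matrix.of fun k l => ∏ i ∈ s, A i k l) := by
      ext k l
      simp [Finset.prod_insert ha]
    rw [h]
    exact (hA a (Finset.mem_insert_self a s)).hadamard
      (ih fun i hi => hA i (Finset.mem_insert_of_mem hi))

theorem re_sum_nonneg {m : ℕ} {A : Matrix (Fin m) (Fin m) ℂ} (hA : A.PosSemidef)
    (c : Fin m → ℂ) : 0 ≤ (∑ k, ∑ l, conj (c k) * A k l * c l).re := by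
  have h := (Complex.le_def.1 (hA.dotProduct_mulVec_nonneg c)).1
  refine h.trans_eq (congrArg Complex.re ?_)
  simp only [dotProduct, Matrix.mulVec, Finset.mul_sum, mul_assoc]
  rfl

theorem innerForm_self_nonneg (t : Alg H) : 0 ≤ (innerForm t t).re := by
  obtain ⟨m, c, x, rfl⟩ := alg_exists_sum t
  rw [innerForm_sum]
  exact re_sum_nonneg (posSemidef_prod Finset.univ
    (fun i => Matrix.gram ℂ fun k => x k i) fun i _ => Matrix.posSemidef_gram ℂ _) c

theorem conj_innerForm (s t : Alg H) : conj (innerForm s t) = innerForm t s := by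
  obtain ⟨m, c, x, rfl⟩ := alg_exists_sum s
  obtain ⟨p, d, y, rfl⟩ := alg_exists_sum t
  simp only [map_sum, map_smul, LinearMap.sum_apply, LinearMap.smul_apply, map_smulₛₗ,
    innerForm_algTmul, smul_eq_mul, map_mul, map_prod, inner_conj_symm, Finset.mul_sum]
  rw [Finset.sum_comm]
  refine Finset.sum_congr rfl fun k _ => Finset.sum_congr rfl fun l _ => ?_
  simp only [RCLike.conj_conj]
  ring

/-- The inner product of the algebraic tensor product. It is conjugate linear in the first
argument and `⟪x_1 ⊗ ⋯ ⊗ x_n, y_1 ⊗ ⋯ ⊗ y_n⟫ = ∏ i, ⟪x_i, y_i⟫`. -/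
instance : PreInnerProductSpace.Core ℂ (Alg H) where
  inner s t := innerForm t s
  conj_inner_symm s t := conj_innerForm s t
  re_inner_nonneg t := innerForm_self_nonneg t
  add_left s t u := map_add (innerForm u) s t
  smul_left s t r := by rw [map_smulₛₗ]; rfl

instance : SeminormedAddCommGroup (Alg H) :=
  InnerProductSpace.Core.toSeminormedAddCommGroup (𝕜 := ℂ)

instance : InnerProductSpace ℂ (Alg H) := .ofCore _

theorem inner_alg_def (s t : Alg H) : inner ℂ s t = innerForm t s := rfl

end Algebraic

section Space

open scoped ComplexOrder

variable {ι : Type*} [Fintype ι] {H : ι → Type*}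
  [∀ i, NormedAddCommGroup (H i)] [∀ i, InnerProductSpace ℂ (H i)]

/-- The Hilbert space tensor product `H_1 ⊗ ⋯ ⊗ H_n`: the completion of the algebraic tensor
product for the inner product with `⟪x_1 ⊗ ⋯ ⊗ x_n, y_1 ⊗ ⋯ ⊗ y_n⟫ = ∏ i, ⟪x_i, y_i⟫`. -/
abbrev Space {ι : Type*} [Fintype ι] (H : ι → Type*)
    [∀ i, NormedAddCommGroup (H i)] [∀ i, InnerProductSpace ℂ (H i)] : Type _ :=
  UniformSpace.Completion (Alg H)

/-- The elementary tensor `x_1 ⊗ ⋯ ⊗ x_n` in the Hilbert space tensor product. -/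
def tmul (x : ∀ i, H i) : Space H := ((algTmul x : Alg H) : UniformSpace.Completion (Alg H))

theorem inner_tmul (x y : ∀ i, H i) :
    inner ℂ (tmul x) (tmul y) = ∏ i, inner ℂ (x i) (y i) := by
  rw [tmul, tmul, UniformSpace.Completion.inner_coe, inner_alg_def, innerForm_algTmul]

/-- The elementary tensors span a dense subspace. -/
theorem span_tmul_dense :
    (Submodule.span ℂ (Set.range (tmul (H := H)))).topologicalClosure = ⊤ := by
  have h : Submodule.span ℂ (Set.range (tmul (H := H))) =
      LinearMap.range (UniformSpace.Completion.toComplL (𝕜 := ℂ) (E := Alg H)).toLinearMap := by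
    rw [← Submodule.map_top, ← alg_span_eq_top, Submodule.map_span, ← Set.range_comp]
    rfl
  rw [h, Submodule.eq_top_iff']
  intro z
  exact UniformSpace.Completion.denseRange_coe z

/-- The closed subspace `Q_1 ⊗ ⋯ ⊗ Q_n` of `H_1 ⊗ ⋯ ⊗ H_n`: the closed linear span of the
elementary tensors `q_1 ⊗ ⋯ ⊗ q_n` with `q_i ∈ Q_i`. -/
def subTensor (Q : ∀ i, Submodule ℂ (H i)) : Submodule ℂ (Space H) :=
  (Submodule.span ℂ (tmul '' {x | ∀ i, x i ∈ Q i})).topologicalClosure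

variable [DecidableEq ι]

/-- `I ⊗ ⋯ ⊗ I ⊗ A ⊗ I ⊗ ⋯ ⊗ I` (with `A` in position `i`) on the algebraic tensor product. -/
def algAmpl (i : ι) (A : H i →L[ℂ] H i) : Alg H →ₗ[ℂ] Alg H :=
  PiTensorProduct.map (R := ℂ) (s := H) (t := H)
    (Function.update (fun _ => LinearMap.id) i A.toLinearMap)

theorem algAmpl_algTmul (i : ι) (A : H i →L[ℂ] H i) (x : ∀ i, H i) :
    algAmpl i A (algTmul x) = algTmul (Function.update x i (A (x i))) := by
  have h : algAmpl i A (algTmul x) = algTmul fun j =>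
      (Function.update (fun _ => LinearMap.id) i A.toLinearMap : ∀ j, H j →ₗ[ℂ] H j) j (x j) :=
    PiTensorProduct.map_tprod _ x
  rw [h]
  congr 1
  ext j
  by_cases hj : j = i
  · subst hj; simp
  · simp [hj]

theorem norm_algAmpl_le (i : ι) (A : H i →L[ℂ] H i) (t : Alg H) :
    ‖algAmpl i A t‖ ≤ ‖A‖ * ‖t‖ := by
  refine abs_le_of_sq_le_sq' ?_ (by positivity) |>.2
  rw [mul_pow, InnerProductSpace.norm_sq_eq_re_inner (𝕜 := ℂ) (algAmpl i A t),
    InnerProductSpace.norm_sq_eq_re_inner (𝕜 := ℂ) t, inner_alg_def, inner_alg_def]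
  obtain ⟨m, c, x, rfl⟩ := alg_exists_sum t
  have hM := posSemidef_prod Finset.univ
    (Function.update (fun j => Matrix.gram ℂ fun k => x k j) i
      (‖A‖ ^ 2 • Matrix.gram ℂ (fun k => x k i) - Matrix.gram ℂ (A ∘ fun k => x k i)))
    (by
      intro j _
      by_cases hj : j = i
      · subst hj
        rw [Function.update_self]
        exact Matrix.posSemidef_opNorm_smul_gram_sub_gram _ A
      · rw [Function.update_of_ne hj]
        exact Matrix.posSemidef_gram ℂ _)
  have h0 := re_sum_nonneg hM c
  rw [← sub_nonneg]
  refine h0.trans_eq ?_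
  have hA : algAmpl i A (∑ k, c k • algTmul (x k)) =
      ∑ k, c k • algTmul (Function.update (x k) i (A (x k i))) := by
    simp only [map_sum, map_smul, algAmpl_algTmul]
  rw [hA, innerForm_sum, innerForm_sum, RCLike.re_eq_complex_re, ← Complex.re_ofReal_mul,
    ← Complex.sub_re, Finset.mul_sum, ← Finset.sum_sub_distrib]
  refine congrArg Complex.re (Finset.sum_congr rfl fun k _ => ?_)
  rw [Finset.mul_sum, ← Finset.sum_sub_distrib]
  refine Finset.sum_congr rfl fun l _ => ?_
  rw [Matrix.of_apply]
  simp only [← Finset.mul_prod_erase _ _ (Finset.mem_univ i), Function.update_self]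
  have e1 : ∏ j ∈ Finset.univ.erase i, (Function.update (fun j => Matrix.gram ℂ fun k => x k j) i
      (‖A‖ ^ 2 • Matrix.gram ℂ (fun k => x k i) - Matrix.gram ℂ (A ∘ fun k => x k i)) j) k l =
      ∏ j ∈ Finset.univ.erase i, inner ℂ (x k j) (x l j) :=
    Finset.prod_congr rfl fun j hj => by
      rw [Function.update_of_ne (Finset.ne_of_mem_erase hj)]
      rfl
  have e2 : ∏ j ∈ Finset.univ.erase i, inner ℂ (Function.update (x k) i (A (x k i)) j)
      (Function.update (x l) i (A (x l i)) j) =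
      ∏ j ∈ Finset.univ.erase i, inner ℂ (x k j) (x l j) :=
    Finset.prod_congr rfl fun j hj => by
      rw [Function.update_of_ne (Finset.ne_of_mem_erase hj),
        Function.update_of_ne (Finset.ne_of_mem_erase hj)]
  rw [e1, e2]
  simp only [Matrix.sub_apply, Matrix.smul_apply, Matrix.gram_apply, Function.comp_apply,
    Complex.real_smul]
  ring

/-- The bounded operator `I ⊗ ⋯ ⊗ I ⊗ A ⊗ I ⊗ ⋯ ⊗ I` (with `A` in position `i`) on the Hilbert
space tensor product. -/
def ampl (i : ι) (A : H i →L[ℂ] H i) : Space H →L[ℂ] Space H :=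
  ContinuousLinearMap.extend
    (UniformSpace.Completion.toComplL.comp ((algAmpl i A).mkContinuous ‖A‖ (norm_algAmpl_le i A)))
    (UniformSpace.Completion.toComplL (𝕜 := ℂ) (E := Alg H))

theorem ampl_tmul (i : ι) (A : H i →L[ℂ] H i) (x : ∀ i, H i) :
    ampl i A (tmul x) = tmul (Function.update x i (A (x i))) := by
  have h := ContinuousLinearMap.extend_eq
    (UniformSpace.Completion.toComplL.comp ((algAmpl i A).mkContinuous ‖A‖ (norm_algAmpl_le i A)))
    (e := UniformSpace.Completion.toComplL (𝕜 := ℂ) (E := Alg H))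
    UniformSpace.Completion.denseRange_coe
    (UniformSpace.Completion.isUniformInducing_coe _) (algTmul x)
  refine Eq.trans h ?_
  simp [tmul, algAmpl_algTmul]

end Space

end HilbertTensor

section Multiplicity

/-- The closed subspace `[G]_A`: the closed linear span of all `A_1 ^ k_1 ⋯ A_n ^ k_n g` with
`k_1, …, k_n ≥ 0` and `g ∈ G`. -/
def generatedSubspace {n : ℕ} {K : Type*} [NormedAddCommGroup K] [InnerProductSpace ℂ K]
    (A : Fin n → K →L[ℂ] K) (G : Set K) : Submodule ℂ K :=
  (Submodule.span ℂ
    (⋃ k : Fin n → ℕ, (List.ofFn fun i => A i ^ k i).prod '' G)).topologicalClosure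

/-- The multiplicity of the tuple `A`: the least cardinality of a set `G` with `[G]_A = K`. -/
def tupleMultiplicity {n : ℕ} {K : Type*} [NormedAddCommGroup K] [InnerProductSpace ℂ K]
    (A : Fin n → K →L[ℂ] K) : Cardinal :=
  sInf {c | ∃ G : Set K, generatedSubspace A G = ⊤ ∧ Cardinal.mk G = c}

/-- The compression `P_L A|_L` of an operator `A` to a subspace `L`. -/
def compression {K : Type*} [NormedAddCommGroup K] [InnerProductSpace ℂ K]
    (L : Submodule ℂ K) [L.HasOrthogonalProjection] (A : K →L[ℂ] K) : L →L[ℂ] L :=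
  L.orthogonalProjectionOnto.comp (A.comp L.subtypeL)

end Multiplicity

section Subspaces

open HilbertTensor

variable {n : ℕ} {H : Fin n → Type*} [∀ i, NormedAddCommGroup (H i)]
  [∀ i, InnerProductSpace ℂ (H i)] [∀ i, CompleteSpace (H i)]

/-- `P_i`: the orthogonal projection of `H_i` onto `S_i = Q_i^⊥`. -/
def projP (Q : ∀ i, Submodule ℂ (H i)) (i : Fin n) : H i →L[ℂ] H i := (Q i)ᗮ.starProjection

/-- `Q_i = I - P_i`: for closed `Q_i`, the orthogonal projection of `H_i` onto `Q_i`. -/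
def projQ (Q : ∀ i, Submodule ℂ (H i)) (i : Fin n) : H i →L[ℂ] H i := 1 - projP Q i

/-- `S = (Q_1 ⊗ ⋯ ⊗ Q_n)^⊥`. -/
def subspaceS (Q : ∀ i, Submodule ℂ (H i)) : Submodule ℂ (Space H) := (subTensor Q)ᗮ

/-- `M_i`: the range of `P̃_i ∏_{j ≠ i} Q̃_j` (the product taken in increasing order of `j`). -/
def subspaceM (Q : ∀ i, Submodule ℂ (H i)) (i : Fin n) : Submodule ℂ (Space H) :=
  (ampl i (projP Q i) *
    (List.ofFn fun j => if j = i then 1 else ampl j (projQ Q j)).prod).range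

/-- `F = M_1 ⊕ ⋯ ⊕ M_n`, the Hilbert space direct sum (closure of the sum) inside
`H_1 ⊗ ⋯ ⊗ H_n`. -/
def subspaceF (Q : ∀ i, Submodule ℂ (H i)) : Submodule ℂ (Space H) :=
  (⨆ i, subspaceM Q i).topologicalClosure

instance (Q : ∀ i, Submodule ℂ (H i)) : (subspaceF Q).HasOrthogonalProjection :=
  inferInstanceAs ((⨆ i, subspaceM Q i).topologicalClosure.HasOrthogonalProjection)

end Subspaces

end

/-! The orthogonal projection onto `F`, restricted to `S`, is a surjection `S → F` (it fixes `F ⊆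
S`) that intertwines each `T̃_i|_S` with its compression to `F`. Such a map carries generating sets
to generating sets, so the multiplicity cannot increase (`tupleMultiplicity_le_of_intertwine`).

Intertwining means that `T̃_i` maps `S ⊖ F` into `F^⊥`. A vector of `S ⊖ F` is orthogonal to every
elementary tensor with at most one factor outside the `Q_j` (`inner_tmul_eq_zero`), and this family
of tensors is stable under `T̃_i^*`: the adjoint changes one factor only, which either is the
exceptional one or stays in `Q_i` (`ampl_mem_orthogonal_subspaceF`). The relation itself is
`projection_ampl`; together with the invariance of `S` it also makes the compressions commute. -/

namespace HilbertTensor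

/-! ### Reduction to elementary tensors by density. -/

variable {ι : Type*} [Fintype ι] {H : ι → Type*}
  [∀ i, NormedAddCommGroup (H i)] [∀ i, InnerProductSpace ℂ (H i)]

/-- A bounded operator that maps all elementary tensors into a closed subspace maps the whole
tensor product into it. -/
theorem apply_mem_of_tmul {Y : Type*} [NormedAddCommGroup Y] [InnerProductSpace ℂ Y]
    (f : Space H →L[ℂ] Y) {W : Submodule ℂ Y} (hW : IsClosed (W : Set Y))
    (h : ∀ x, f (tmul x) ∈ W) (z : Space H) : f z ∈ W := by
  have hle : (Submodule.span ℂ (Set.range (tmul (H := H)))).topologicalClosure ≤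
      W.comap f.toLinearMap := by
    refine Submodule.topologicalClosure_minimal _ (Submodule.span_le.2 ?_)
      (hW.preimage f.continuous)
    rintro _ ⟨x, rfl⟩
    exact h x
  rw [span_tmul_dense] at hle
  exact hle (Submodule.mem_top (x := z))

theorem ext_tmul {Y : Type*} [NormedAddCommGroup Y] [InnerProductSpace ℂ Y]
    {f g : Space H →L[ℂ] Y} (h : ∀ x, f (tmul x) = g (tmul x)) : f = g := by
  ext z
  have := apply_mem_of_tmul (f - g) (W := ⊥) isClosed_singleton (fun x => by simp [h x]) z
  simpa [sub_eq_zero] using this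

theorem inner_apply_eq_zero_of_tmul {Y : Type*} [NormedAddCommGroup Y] [InnerProductSpace ℂ Y]
    {f g : Space H →L[ℂ] Y} (h : ∀ x y, inner ℂ (f (tmul x)) (g (tmul y)) = 0)
    (z w : Space H) : inner ℂ (f z) (g w) = 0 := by
  -- Density is used in one variable at a time, since an orthogonal complement is a closed subspace.
  have h1 : ∀ x w, inner ℂ (f (tmul x)) (g w) = 0 := fun x w =>
    Submodule.mem_orthogonal_singleton_iff_inner_right.1
      (apply_mem_of_tmul g (Submodule.isClosed_orthogonal _)
        (fun y => Submodule.mem_orthogonal_singleton_iff_inner_right.2 (h x y)) w)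
  exact Submodule.mem_orthogonal_singleton_iff_inner_left.1
    (apply_mem_of_tmul f (Submodule.isClosed_orthogonal _)
      (fun x => Submodule.mem_orthogonal_singleton_iff_inner_left.2 (h1 x w)) z)

theorem tmul_eq_zero (x : ∀ i, H i) (i : ι) (hi : x i = 0) : tmul x = 0 := by
  have h : algTmul x = (0 : Alg H) := algTmul.map_coord_zero i hi
  rw [tmul, h, UniformSpace.Completion.coe_zero]

variable [DecidableEq ι]

theorem tmul_update_add (x : ∀ i, H i) (i : ι) (a b : H i) :
    tmul (Function.update x i (a + b)) =
      tmul (Function.update x i a) + tmul (Function.update x i b) := by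
  simp only [tmul]
  rw [algTmul.map_update_add, UniformSpace.Completion.coe_add]

theorem inner_ampl_left [∀ i, CompleteSpace (H i)] (i : ι) (A : H i →L[ℂ] H i)
    (z w : Space H) :
    inner ℂ (ampl i A z) w = inner ℂ z (ampl i (ContinuousLinearMap.adjoint A) w) := by
  have key : ∀ x y : ∀ i, H i, inner ℂ (ampl i A (tmul x)) (tmul y) =
      inner ℂ (tmul x) (ampl i (ContinuousLinearMap.adjoint A) (tmul y)) := by
    intro x y
    rw [ampl_tmul, ampl_tmul, inner_tmul, inner_tmul]
    refine Finset.prod_congr rfl fun j _ => ?_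
    by_cases hj : j = i
    · subst hj
      simp [ContinuousLinearMap.adjoint_inner_right]
    · simp [Function.update_of_ne hj]
  have h := inner_apply_eq_zero_of_tmul (f := ContinuousLinearMap.id ℂ (Space H))
    (g := ContinuousLinearMap.adjoint (ampl i A) - ampl i (ContinuousLinearMap.adjoint A))
    (fun x y => by
      simp [ContinuousLinearMap.adjoint_inner_right, key]) z w
  simpa [inner_sub_right, ContinuousLinearMap.adjoint_inner_right, sub_eq_zero] using h

theorem ampl_comm {i j : ι} (hij : i ≠ j) (A : H i →L[ℂ] H i) (B : H j →L[ℂ] H j) :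
    ampl i A * ampl j B = ampl j B * ampl i A := by
  refine ext_tmul fun x => ?_
  simp only [mul_apply_eq_comp, ampl_tmul, Function.update_of_ne hij,
    Function.update_of_ne hij.symm]
  rw [Function.update_comm hij]

/-- Distinct list entries act on distinct factors, so no `A j` is applied twice. A general list
makes the induction possible; `List.finRange n` is the case needed. -/
theorem list_prod_ampl_tmul (A : ∀ j, H j →L[ℂ] H j) (i : ι) (l : List ι) (hl : l.Nodup)
    (x : ∀ j, H j) :
    (l.map fun j => if j = i then 1 else ampl j (A j)).prod (tmul x) =
      tmul fun j => if j ∈ l ∧ j ≠ i then A j (x j) else x j := by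
  induction l with
  | nil => simp
  | cons a l ih =>
    rw [List.nodup_cons] at hl
    rw [List.map_cons, List.prod_cons, mul_apply_eq_comp, ih hl.2]
    by_cases ha : a = i
    · subst ha
      rw [if_pos rfl, one_apply_eq_self]
      congr 1
      ext j
      by_cases hj : j = a <;> simp [hj]
    · rw [if_neg ha, ampl_tmul]
      congr 1
      ext j
      by_cases hj : j = a
      · subst hj
        simp [ha, hl.1]
      · simp [hj]

end HilbertTensor

universe u

/-! ### Multiplicity and intertwining maps. -/

section Multiplicity

variable {n : ℕ} {K L : Type*} [NormedAddCommGroup K] [InnerProductSpace ℂ K]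
  [NormedAddCommGroup L] [InnerProductSpace ℂ L]

/-- Cardinals are well ordered, so the infimum is attained once some generating set exists; the
whole space is one, already with all exponents zero. -/
theorem exists_generatedSubspace_eq_top (A : Fin n → K →L[ℂ] K) :
    ∃ G : Set K, generatedSubspace A G = ⊤ ∧ Cardinal.mk G = tupleMultiplicity A := by
  have hne : {c | ∃ G : Set K, generatedSubspace A G = ⊤ ∧ Cardinal.mk G = c}.Nonempty := by
    refine ⟨_, Set.univ, ?_, rfl⟩
    refine top_unique (le_trans ?_ (Submodule.le_topologicalClosure _))
    intro x _
    refine Submodule.subset_span (Set.mem_iUnion.2 ⟨0, x, trivial, ?_⟩)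
    simp
  exact csInf_mem hne

theorem tupleMultiplicity_le_mk {A : Fin n → K →L[ℂ] K} {G : Set K}
    (h : generatedSubspace A G = ⊤) : tupleMultiplicity A ≤ Cardinal.mk G :=
  csInf_le' ⟨G, h, rfl⟩

theorem pow_intertwine {A : K →L[ℂ] K} {B : L →L[ℂ] L} {p : K →L[ℂ] L}
    (h : ∀ x, p (A x) = B (p x)) (m : ℕ) (x : K) : p ((A ^ m) x) = (B ^ m) (p x) := by
  induction m generalizing x with
  | zero => simp
  | succ m ih => rw [pow_succ, pow_succ, mul_apply_eq_comp,
      mul_apply_eq_comp, ih, h]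

theorem list_prod_intertwine {κ : Type*} {A : κ → K →L[ℂ] K} {B : κ → L →L[ℂ] L}
    {p : K →L[ℂ] L} (h : ∀ i x, p (A i x) = B i (p x)) (l : List κ) (x : K) :
    p ((l.map A).prod x) = (l.map B).prod (p x) := by
  induction l with
  | nil => simp
  | cons a l ih => simp [h, ih]

/-- The multiplicity does not increase under a surjective intertwining map. -/
theorem tupleMultiplicity_le_of_intertwine {K L : Type u} [NormedAddCommGroup K]
    [InnerProductSpace ℂ K] [NormedAddCommGroup L] [InnerProductSpace ℂ L]
    {A : Fin n → K →L[ℂ] K} {B : Fin n → L →L[ℂ] L}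
    (p : K →L[ℂ] L) (hp : Function.Surjective p) (h : ∀ i x, p (A i x) = B i (p x)) :
    tupleMultiplicity B ≤ tupleMultiplicity A := by
  obtain ⟨G, hG, hc⟩ := exists_generatedSubspace_eq_top A
  rw [← hc]
  refine (tupleMultiplicity_le_mk ?_).trans (Cardinal.mk_image_le (f := p) (s := G))
  -- The preimage is a closed subspace, so it suffices to check the vectors `A^k g`, which `p` sends
  -- to `B^k (p g)`.
  have hle : generatedSubspace A G ≤ (generatedSubspace B (p '' G)).comap p.toLinearMap := by
    refine Submodule.topologicalClosure_minimal _ (Submodule.span_le.2 ?_)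
      ((Submodule.isClosed_topologicalClosure _).preimage p.continuous)
    refine Set.iUnion_subset fun k => ?_
    rintro _ ⟨g, hg, rfl⟩
    refine Submodule.le_topologicalClosure _ (Submodule.subset_span
      (Set.mem_iUnion.2 ⟨k, p g, ⟨g, hg, rfl⟩, ?_⟩))
    have := list_prod_intertwine (A := fun i => A i ^ k i) (B := fun i => B i ^ k i)
      (fun i => pow_intertwine (h i) (k i)) (List.finRange n) g
    simp only [List.ofFn_eq_map]
    exact this.symm
  rw [hG] at hle
  refine top_unique fun y _ => ?_
  obtain ⟨x, rfl⟩ := hp y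
  exact hle (Submodule.mem_top (x := x))

end Multiplicity

/-! ### The blocks `M_k`, their sum `F`, and `S`. -/

section Subspaces

open HilbertTensor

variable {n : ℕ} {H : Fin n → Type*} [∀ i, NormedAddCommGroup (H i)]
  [∀ i, InnerProductSpace ℂ (H i)] [∀ i, CompleteSpace (H i)]

theorem projP_mem (Q : ∀ i, Submodule ℂ (H i)) (i : Fin n) (x : H i) :
    projP Q i x ∈ (Q i)ᗮ := Submodule.starProjection_apply_mem _ _

theorem projP_of_mem (Q : ∀ i, Submodule ℂ (H i)) {i : Fin n} {x : H i} (hx : x ∈ (Q i)ᗮ) :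
    projP Q i x = x := Submodule.starProjection_eq_self_iff.2 hx

theorem projP_eq_zero_of_mem (Q : ∀ i, Submodule ℂ (H i)) {i : Fin n} {x : H i} (hx : x ∈ Q i) :
    projP Q i x = 0 :=
  (Submodule.starProjection_apply_eq_zero_iff _).2 (Submodule.le_orthogonal_orthogonal _ hx)

theorem projQ_apply (Q : ∀ i, Submodule ℂ (H i)) (i : Fin n) (x : H i) :
    projQ Q i x = x - projP Q i x := rfl

/-- Closedness enters here, through `Q_i^⊥⊥ = Q_i`. -/
theorem projQ_mem (Q : ∀ i, Submodule ℂ (H i)) (hQ : ∀ i, IsClosed (Q i : Set (H i)))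
    (i : Fin n) (x : H i) : projQ Q i x ∈ Q i := by
  have h : x - projP Q i x ∈ (Q i)ᗮᗮ := Submodule.sub_starProjection_mem_orthogonal x
  rwa [Submodule.orthogonal_orthogonal_eq_closure,
    (hQ i).submodule_topologicalClosure_eq] at h

theorem projQ_of_mem (Q : ∀ i, Submodule ℂ (H i)) {i : Fin n} {x : H i} (hx : x ∈ Q i) :
    projQ Q i x = x := by
  rw [projQ_apply, projP_eq_zero_of_mem Q hx, sub_zero]

/-- The factor in position `j` of the projection onto `M_k`. -/
noncomputable def blockFactor (Q : ∀ i, Submodule ℂ (H i)) (k j : Fin n) : H j →L[ℂ] H j :=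
  if j = k then projP Q j else projQ Q j

theorem blockFactor_self (Q : ∀ i, Submodule ℂ (H i)) (k : Fin n) :
    blockFactor Q k k = projP Q k := if_pos rfl

theorem blockFactor_of_ne (Q : ∀ i, Submodule ℂ (H i)) {k j : Fin n} (h : j ≠ k) :
    blockFactor Q k j = projQ Q j := if_neg h

/-- The projection `P̃_k ∏_{j ≠ k} Q̃_j` onto `M_k`. -/
noncomputable def blockProj (Q : ∀ i, Submodule ℂ (H i)) (k : Fin n) : Space H →L[ℂ] Space H :=
  ampl k (projP Q k) * (List.ofFn fun j => if j = k then 1 else ampl j (projQ Q j)).prod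

theorem subspaceM_eq_range (Q : ∀ i, Submodule ℂ (H i)) (k : Fin n) :
    subspaceM Q k = (blockProj Q k).range := rfl

theorem blockProj_tmul (Q : ∀ i, Submodule ℂ (H i)) (k : Fin n) (x : ∀ i, H i) :
    blockProj Q k (tmul x) = tmul fun j => blockFactor Q k j (x j) := by
  rw [blockProj, mul_apply_eq_comp, List.ofFn_eq_map,
    list_prod_ampl_tmul _ _ _ (List.nodup_finRange n), ampl_tmul]
  congr 1
  ext j
  by_cases hj : j = k
  · subst hj
    simp [blockFactor_self]
  · simp [hj, blockFactor_of_ne Q hj]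

theorem blockProj_mul_self (Q : ∀ i, Submodule ℂ (H i)) (hQ : ∀ i, IsClosed (Q i : Set (H i)))
    (k : Fin n) : blockProj Q k * blockProj Q k = blockProj Q k := by
  refine ext_tmul fun x => ?_
  rw [mul_apply_eq_comp, blockProj_tmul, blockProj_tmul]
  congr 1
  ext j
  by_cases hj : j = k
  · subst hj
    rw [blockFactor_self, projP_of_mem Q (projP_mem Q _ _)]
  · rw [blockFactor_of_ne Q hj, projQ_of_mem Q (projQ_mem Q hQ _ _)]

theorem blockProj_mul_of_ne (Q : ∀ i, Submodule ℂ (H i)) (hQ : ∀ i, IsClosed (Q i : Set (H i)))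
    {k l : Fin n} (hkl : k ≠ l) : blockProj Q k * blockProj Q l = 0 := by
  refine ext_tmul fun x => ?_
  rw [mul_apply_eq_comp, blockProj_tmul, blockProj_tmul,
    zero_apply]
  refine tmul_eq_zero _ k ?_
  rw [blockFactor_self, blockFactor_of_ne Q hkl, projP_eq_zero_of_mem Q (projQ_mem Q hQ _ _)]

/-- In position `k` one tensor has a factor in `Q_k^⊥` and the other a factor in `Q_k`. -/
theorem subspaceM_isOrtho (Q : ∀ i, Submodule ℂ (H i)) (hQ : ∀ i, IsClosed (Q i : Set (H i)))
    {k l : Fin n} (hkl : k ≠ l) : Submodule.IsOrtho (subspaceM Q k) (subspaceM Q l) := by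
  rw [Submodule.isOrtho_iff_inner_eq]
  rintro _ ⟨z, rfl⟩ _ ⟨w, rfl⟩
  refine inner_apply_eq_zero_of_tmul (f := blockProj Q k) (g := blockProj Q l) (fun x y => ?_) z w
  rw [blockProj_tmul, blockProj_tmul, inner_tmul]
  refine Finset.prod_eq_zero (Finset.mem_univ k) ?_
  rw [blockFactor_self, blockFactor_of_ne Q hkl]
  exact Submodule.inner_left_of_mem_orthogonal (projQ_mem Q hQ _ _) (projP_mem Q _ _)

theorem subspaceF_eq_iSup (Q : ∀ i, Submodule ℂ (H i)) (hQ : ∀ i, IsClosed (Q i : Set (H i))) :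
    subspaceF Q = ⨆ i, subspaceM Q i := by
  refine le_antisymm ?_ (Submodule.le_topologicalClosure _)
  -- The sum of the block projections is the identity on every `M_k`, hence by continuity on the
  -- closure; this exhibits each vector of `F` as a finite sum of vectors of the `M_k`.
  have hfix : ∀ z ∈ subspaceF Q, (∑ k, blockProj Q k) z = z := by
    have hle : subspaceF Q ≤ LinearMap.ker ((∑ k, blockProj Q k) - 1).toLinearMap := by
      refine Submodule.topologicalClosure_minimal _ (iSup_le fun k => ?_)
        (ContinuousLinearMap.isClosed_ker _)
      rintro _ ⟨w, rfl⟩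
      have h : (∑ l, blockProj Q l) * blockProj Q k = blockProj Q k := by
        rw [Finset.sum_mul, Finset.sum_eq_single k
          (fun l _ hl => blockProj_mul_of_ne Q hQ hl) (by simp), blockProj_mul_self Q hQ]
      have h' := congrArg (fun f => f w) h
      rw [LinearMap.mem_ker]
      exact sub_eq_zero.2 h'
    exact fun z hz => sub_eq_zero.1 (hle hz)
  intro z hz
  rw [← hfix z hz, sum_apply]
  exact Submodule.sum_mem _ fun k _ =>
    Submodule.mem_iSup_of_mem k ⟨z, rfl⟩

theorem mem_subspaceS_iff (Q : ∀ i, Submodule ℂ (H i)) (z : Space H) :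
    z ∈ subspaceS Q ↔ ∀ q : ∀ i, H i, (∀ i, q i ∈ Q i) → inner ℂ (tmul q) z = 0 := by
  rw [subspaceS, subTensor, Submodule.orthogonal_closure, Submodule.mem_orthogonal]
  refine ⟨fun h q hq => h _ (Submodule.subset_span ⟨q, hq, rfl⟩), fun h u hu => ?_⟩
  have hle : Submodule.span ℂ (tmul '' {x : ∀ i, H i | ∀ i, x i ∈ Q i}) ≤ (ℂ ∙ z)ᗮ := by
    rw [Submodule.span_le]
    rintro _ ⟨q, hq, rfl⟩
    exact Submodule.mem_orthogonal_singleton_iff_inner_left.2 (h q hq)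
  exact Submodule.mem_orthogonal_singleton_iff_inner_left.1 (hle hu)

theorem mem_orthogonal_subspaceF_iff (Q : ∀ i, Submodule ℂ (H i)) (z : Space H) :
    z ∈ (subspaceF Q)ᗮ ↔
      ∀ k, ∀ x : ∀ i, H i, inner ℂ (tmul fun j => blockFactor Q k j (x j)) z = 0 := by
  rw [subspaceF, Submodule.orthogonal_closure, ← Submodule.iInf_orthogonal, Submodule.mem_iInf]
  refine forall_congr' fun k => ⟨fun h x => ?_, ?_⟩
  · rw [← blockProj_tmul]
    exact h _ ⟨tmul x, rfl⟩
  · rintro h _ ⟨w, rfl⟩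
    refine Submodule.mem_orthogonal_singleton_iff_inner_left.1
      (apply_mem_of_tmul (blockProj Q k) (Submodule.isClosed_orthogonal _) (fun x => ?_) w)
    rw [Submodule.mem_orthogonal_singleton_iff_inner_left, blockProj_tmul]
    exact h x

theorem subspaceF_le_subspaceS (Q : ∀ i, Submodule ℂ (H i)) : subspaceF Q ≤ subspaceS Q := by
  refine Submodule.topologicalClosure_minimal _ (iSup_le fun k => ?_)
    (Submodule.isClosed_orthogonal _)
  rintro _ ⟨w, rfl⟩
  refine apply_mem_of_tmul (blockProj Q k) (Submodule.isClosed_orthogonal _) (fun x => ?_) w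
  refine (mem_subspaceS_iff Q _).2 fun q hq => ?_
  rw [blockProj_tmul, inner_tmul]
  refine Finset.prod_eq_zero (Finset.mem_univ k) ?_
  rw [blockFactor_self]
  exact Submodule.inner_right_of_mem_orthogonal (hq k) (projP_mem Q _ _)

/-! ### Invariance and the intertwining relation. -/

variable {T : ∀ i, H i →L[ℂ] H i} {Q : ∀ i, Submodule ℂ (H i)}

theorem inner_tmul_ampl (i : Fin n) (A : H i →L[ℂ] H i) (y : ∀ i, H i) (z : Space H) :
    inner ℂ (tmul y) (ampl i A z) =
      inner ℂ (tmul (Function.update y i (ContinuousLinearMap.adjoint A (y i)))) z := by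
  rw [← ampl_tmul, inner_ampl_left, ContinuousLinearMap.adjoint_adjoint]

theorem ampl_mem_subspaceS (hT : ∀ i, ∀ x ∈ Q i, ContinuousLinearMap.adjoint (T i) x ∈ Q i)
    (i : Fin n) {z : Space H} (hz : z ∈ subspaceS Q) : ampl i (T i) z ∈ subspaceS Q := by
  rw [mem_subspaceS_iff] at hz ⊢
  intro q hq
  rw [inner_tmul_ampl]
  refine hz _ fun j => ?_
  by_cases hj : j = i
  · subst hj
    simpa using hT j _ (hq j)
  · simpa [hj] using hq j

/-- A vector of `S` orthogonal to `F` is orthogonal to all elementary tensors with at most one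
factor outside of the `Q_j`. -/
theorem inner_tmul_eq_zero {z : Space H} (hz : z ∈ subspaceS Q)
    (hz' : z ∈ (subspaceF Q)ᗮ) (hQ : ∀ i, IsClosed (Q i : Set (H i))) (k : Fin n)
    (y : ∀ i, H i) (hy : ∀ j, j ≠ k → y j ∈ Q j) : inner ℂ (tmul y) z = 0 := by
  -- Split the exceptional factor along `Q_k^⊥ ⊕ Q_k`: the first part gives a tensor in `M_k`, the
  -- second a tensor with all factors in the `Q_j`.
  have e : y = Function.update y k (projP Q k (y k) + projQ Q k (y k)) := by
    rw [projQ_apply, add_sub_cancel, Function.update_eq_self]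
  have e1 : Function.update y k (projP Q k (y k)) = fun j => blockFactor Q k j (y j) := by
    ext j
    by_cases hj : j = k
    · subst hj
      simp [blockFactor_self]
    · rw [Function.update_of_ne hj, blockFactor_of_ne Q hj, projQ_of_mem Q (hy j hj)]
  rw [e, tmul_update_add, inner_add_left, e1, (mem_orthogonal_subspaceF_iff Q z).1 hz' k y,
    zero_add]
  refine (mem_subspaceS_iff Q z).1 hz _ fun j => ?_
  by_cases hj : j = k
  · subst hj
    simpa using projQ_mem Q hQ j (y j)
  · simpa [hj] using hy j hj

theorem ampl_mem_orthogonal_subspaceF (hQ : ∀ i, IsClosed (Q i : Set (H i)))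
    (hT : ∀ i, ∀ x ∈ Q i, ContinuousLinearMap.adjoint (T i) x ∈ Q i) (i : Fin n)
    {z : Space H} (hz : z ∈ subspaceS Q) (hz' : z ∈ (subspaceF Q)ᗮ) :
    ampl i (T i) z ∈ (subspaceF Q)ᗮ := by
  rw [mem_orthogonal_subspaceF_iff]
  intro k x
  rw [inner_tmul_ampl]
  -- Position `k` is exempt, so the case `i = k` needs nothing of `T_k`; for `i ≠ k` the adjoint
  -- keeps the factor in `Q_i`.
  refine inner_tmul_eq_zero hz hz' hQ k _ fun j hj => ?_
  have hmem : blockFactor Q k j (x j) ∈ Q j := by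
    rw [blockFactor_of_ne Q hj]
    exact projQ_mem Q hQ _ _
  by_cases hji : j = i
  · subst hji
    simpa using hT j _ hmem
  · simpa [hji] using hmem

/-- The projection onto `F` intertwines `T̃_i` on `S` and the compression of `T̃_i` to `F`. -/
theorem projection_ampl (hQ : ∀ i, IsClosed (Q i : Set (H i)))
    (hT : ∀ i, ∀ x ∈ Q i, ContinuousLinearMap.adjoint (T i) x ∈ Q i) (i : Fin n)
    {z : Space H} (hz : z ∈ subspaceS Q) :
    (subspaceF Q).orthogonalProjectionOnto (ampl i (T i) z) =
      compression (subspaceF Q) (ampl i (T i)) ((subspaceF Q).orthogonalProjectionOnto z) := by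
  set p := (subspaceF Q).orthogonalProjectionOnto with hp
  have hmem : z - p z ∈ (subspaceF Q)ᗮ := Submodule.sub_starProjection_mem_orthogonal z
  have hS : z - p z ∈ subspaceS Q :=
    Submodule.sub_mem _ hz (subspaceF_le_subspaceS Q (p z).2)
  -- `z - p z` lies in `S ⊖ F`, so `T̃_i (z - p z)` projects to zero.
  have h0 := Submodule.orthogonalProjectionOnto_apply_of_mem_orthogonal
    (ampl_mem_orthogonal_subspaceF hQ hT i hS hmem)
  rw [map_sub, map_sub, sub_eq_zero] at h0
  exact h0

theorem compression_commute (hQ : ∀ i, IsClosed (Q i : Set (H i)))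
    (hT : ∀ i, ∀ x ∈ Q i, ContinuousLinearMap.adjoint (T i) x ∈ Q i) (i j : Fin n) :
    Commute (compression (subspaceF Q) (ampl i (T i)))
      (compression (subspaceF Q) (ampl j (T j))) := by
  by_cases hij : i = j
  · subst hij
    exact Commute.refl _
  -- As `T̃_b f` lies in `S`, the intertwining relation removes the inner projection; commutation is
  -- then inherited from `T̃_a` and `T̃_b`.
  have key : ∀ (a b : Fin n) (f : subspaceF Q),
      compression (subspaceF Q) (ampl a (T a)) (compression (subspaceF Q) (ampl b (T b)) f) =
        (subspaceF Q).orthogonalProjectionOnto ((ampl a (T a) * ampl b (T b)) (f : Space H)) :=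
    fun a b f => (projection_ampl hQ hT a
      (ampl_mem_subspaceS hT b (subspaceF_le_subspaceS Q f.2))).symm
  refine ContinuousLinearMap.ext fun f => ?_
  rw [mul_apply_eq_comp, mul_apply_eq_comp, key, key, ampl_comm hij]

end Subspaces

theorem mainTheorem3 {n : ℕ} {H : Fin n → Type*} [∀ i, NormedAddCommGroup (H i)]
    [∀ i, InnerProductSpace ℂ (H i)] [∀ i, CompleteSpace (H i)]
    (T : ∀ i, H i →L[ℂ] H i) (Q : ∀ i, Submodule ℂ (H i))
    (hQ : ∀ i, IsClosed (Q i : Set (H i)))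
    (hT : ∀ i, ∀ x ∈ Q i, ContinuousLinearMap.adjoint (T i) x ∈ Q i) :
    (∀ i j, i ≠ j → Submodule.IsOrtho (subspaceM Q i) (subspaceM Q j)) ∧
    subspaceF Q = ⨆ i, subspaceM Q i ∧
    subspaceF Q ≤ subspaceS Q ∧
    (∀ i j, Commute (compression (subspaceF Q) (HilbertTensor.ampl i (T i)))
      (compression (subspaceF Q) (HilbertTensor.ampl j (T j)))) ∧
    ∃ hS : ∀ i, ∀ x ∈ subspaceS Q, HilbertTensor.ampl i (T i) x ∈ subspaceS Q,
      tupleMultiplicity (fun i => compression (subspaceF Q) (HilbertTensor.ampl i (T i))) ≤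
        tupleMultiplicity (fun i => (HilbertTensor.ampl i (T i)).restrict (hS i)) := by
  refine ⟨fun i j => subspaceM_isOrtho Q hQ, subspaceF_eq_iSup Q hQ, subspaceF_le_subspaceS Q,
    compression_commute hQ hT, fun i _ => ampl_mem_subspaceS hT i, ?_⟩
  refine tupleMultiplicity_le_of_intertwine
    ((subspaceF Q).orthogonalProjectionOnto.comp (subspaceS Q).subtypeL) (fun y => ?_)
    (fun i x => projection_ampl hQ hT i x.2)
  exact ⟨⟨y, subspaceF_le_subspaceS Q y.2⟩,
    Submodule.orthogonalProjectionOnto_mem_subspace_eq_self y⟩
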